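/- Let $\mathbb{F}$ be $\mathbb{R}$ or $\mathbb{C}$, let $X$ and $Y$ be infinite-dimensional Banach spaces over $\mathbb{F}$, and let $\mathcal{A}\subseteq\mathcal{B}(X)$ and $\mathcal{B}\subseteq\mathcal{B}(Y)$ be standard operator algebras, i.e. norm closed subalgebras containing the identity and all bounded finite rank operators. For $n\ge 1$, an operator matrix $T\in M_n(\mathcal{A})$ is called quadratic if $(T-aI)(T-bI)=0$ for some complex numbers $a,b$; if $\mathbb{F}=\mathbb{R}$, one may either require $a,b$ to be real or allow them to be complex, the product then being formed in the complexification of $M_n(\mathcal{A})$ (the theorem holds under each of the two conventions, the same one being used throughout). Quadratic elements of $M_n(\mathcal{B})$ are defined in the same way. For a map $\phi:\mathcal{A}\to\mathcal{B}$ let $\phi_n:M_n(\mathcal{A})\to M_n(\mathcal{B})$, $\phi_n((T_{ij}))=(\phi(T_{ij}))$. Let $\phi:\mathcal{A}\to\mathcal{B}$ be a bijection (not assumed linear or continuous). Then the following are equivalent: (1) $\phi$ completely preserves quadratic operators in both directions: for every $n\ge 1$ and every $T\in M_n(\mathcal{A})$, $T$ is quadratic if and only if $\phi_n(T)$ is quadratic.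 (2) $\phi_2$ preserves quadratic operators in both directions: for every $T\in M_2(\mathcal{A})$, $T$ is quadratic if and only if $\phi_2(T)$ is quadratic. (3) There exist a scalar $\lambda\in\mathbb{F}$ and a bounded invertible linear or (in the complex case) conjugate-linear operator $A:X\to Y$ such that $\phi(T)=\lambda ATA^{-1}$ for all $T\in\mathcal{A}$. -/

import Mathlib

open scoped TensorProduct

/-- A standard operator algebra on a Banach space `X`: a norm closed subalgebra of `B(X)` that
contains the identity (as every `Subalgebra` does) and all bounded operators of finite rank. -/
structure IsStandardOperatorAlgebra {𝕜 X : Type*} [RCLike 𝕜] [NormedAddCommGroup X]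
    [NormedSpace 𝕜 X] (𝒜 : Subalgebra 𝕜 (X →L[𝕜] X)) : Prop where
  isClosed : IsClosed (𝒜 : Set (X →L[𝕜] X))
  finiteRank_mem : ∀ T : X →L[𝕜] X,
    FiniteDimensional 𝕜 (LinearMap.range (T : X →ₗ[𝕜] X)) → T ∈ 𝒜

/-- `T` is quadratic with roots in the scalar extension `L` of `𝕜`: `(T - a I) (T - b I) = 0` for
some `a b : L`, where the product is formed in the algebra `L ⊗[𝕜] R` obtained from `R` by
extension of scalars. For `L = 𝕜` this extension is `R` itself (see `isQuadratic_self_iff`);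
for `𝕜 = ℝ` and `L = ℂ` it is the complexification of `R`. -/
def IsQuadratic (𝕜 L : Type*) {R : Type*} [Field 𝕜] [Field L] [Algebra 𝕜 L] [Ring R]
    [Algebra 𝕜 R] (T : R) : Prop :=
  ∃ a b : L, ((1 : L) ⊗ₜ[𝕜] T - a ⊗ₜ[𝕜] (1 : R)) * ((1 : L) ⊗ₜ[𝕜] T - b ⊗ₜ[𝕜] (1 : R)) = 0

theorem isQuadratic_self_iff {𝕜 R : Type*} [Field 𝕜] [Ring R] [Algebra 𝕜 R] (T : R) :
    IsQuadratic 𝕜 𝕜 T ↔ ∃ a b : 𝕜, (T - a • (1 : R)) * (T - b • (1 : R)) = 0 := by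
  unfold IsQuadratic
  refine exists_congr fun a => exists_congr fun b => ?_
  rw [← (Algebra.TensorProduct.lid 𝕜 R).injective.eq_iff]
  simp

/-- `φ` is `n`-quadratic preserving in both directions: the entrywise map
`φ_n (T_ij) = (φ (T_ij))` between `n × n` operator matrices maps quadratic ones, and only those,
to quadratic ones. -/
def QuadraticPreserving (𝕜 L : Type*) {R S : Type*} [Field 𝕜] [Field L] [Algebra 𝕜 L]
    [Ring R] [Algebra 𝕜 R] [Ring S] [Algebra 𝕜 S] (n : ℕ) (φ : R → S) : Prop :=
  ∀ T : Matrix (Fin n) (Fin n) R, IsQuadratic 𝕜 L T ↔ IsQuadratic 𝕜 L (T.map φ)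

/-- `φ` is completely quadratic preserving in both directions. -/
def CompletelyQuadraticPreserving (𝕜 L : Type*) {R S : Type*} [Field 𝕜] [Field L] [Algebra 𝕜 L]
    [Ring R] [Algebra 𝕜 R] [Ring S] [Algebra 𝕜 S] (φ : R → S) : Prop :=
  ∀ n : ℕ, 1 ≤ n → QuadraticPreserving 𝕜 L n φ

/-- `φ T = c A T A⁻¹` for all `T`, for a scalar `c` and a bounded invertible `A : X → Y` that is
linear or conjugate-linear (if `𝕜 = ℝ`, conjugation is trivial and the two cases coincide). -/
def IsScalarConjugation {𝕜 X Y : Type*} [RCLike 𝕜]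
    [NormedAddCommGroup X] [NormedSpace 𝕜 X] [NormedAddCommGroup Y] [NormedSpace 𝕜 Y]
    {𝒜 : Subalgebra 𝕜 (X →L[𝕜] X)} {ℬ : Subalgebra 𝕜 (Y →L[𝕜] Y)} (φ : 𝒜 → ℬ) : Prop :=
  ∃ c : 𝕜,
    (∃ A : X ≃L[𝕜] Y, ∀ (T : 𝒜) (y : Y),
      (φ T : Y →L[𝕜] Y) y = c • A ((T : X →L[𝕜] X) (A.symm y))) ∨
    (∃ A : X ≃SL[starRingEnd 𝕜] Y, ∀ (T : 𝒜) (y : Y),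
      (φ T : Y →L[𝕜] Y) y = c • A ((T : X →L[𝕜] X) (A.symm y)))

/-!
An element is quadratic with roots in `L` exactly when it satisfies a monic quadratic equation over
`𝕜` whose roots lie in `L` (`isQuadratic_iff_exists_mul_self`). For a semilinear ring homomorphism
this condition is transported by applying the semilinearity to the coefficients, so scalar multiples
of conjugations are completely quadratic preserving.

Conversely, let `φ` be `2`-quadratic preserving. All the work is done by testing `φ` and its inverse
on suitable `2 × 2` block matrices with explicit roots in `𝕜`, and using only that their images
satisfy *some* quadratic equation over `𝕜`; this makes the choice of `L` irrelevant
(`PreservesBlockQuadratic`). Triangular block matrices, together with the one with all entries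
equal, show that `φ 0 = 0`, that `φ` permutes the scalars by some `h`, and, after dividing by a
constant, that it preserves idempotents `E` and the relations `E * T = T` and `T * E = T`. Hence rank-one operators go to rank-one operators, with range
and kernel depending only on the range and the kernel.

The block matrix `(xᵢ ⊗ fⱼ)` satisfies `M * M = (f₁ x₁ + f₂ x₂) • M`, and the same kind of equation
for its image forces the coefficients of the image to be of rank one
(`IsNormalizedPreserver.coeff_mul_coeff_eq`). So `φ (x ⊗ f) = u x ⊗ v f` with
`v f (u x) = h (f x)`, which makes `h` multiplicative. It is additive too: `v (f₁ + f₂)` vanishes on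
the common kernel of `v f₁` and `v f₂`, hence is a combination of them, and biorthogonal vectors show
that the coefficients are `1`. Thus `h` is a field automorphism and `u` is `h`-semilinear, without
an appeal to the fundamental theorem of projective geometry.

Infinite-dimensionality makes `h` continuous by a gliding hump (`continuous_of_dual_apply_eq`),
hence the identity or conjugation, and then the uniform boundedness principle makes `u` and its
inverse bounded. For an arbitrary `T` and `B = x ⊗ f`, the square-zero block
matrix `!![T * B, T; -(B * T * B), -(B * T)]` has entries of rank at most one apart from `T`, and the
equation satisfied by its image gives `φ T (u x) = u (T x)` whenever `f (T x) ≠ 0`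
(`IsNormalizedPreserver.map_apply`).
-/

/-! ### Quadratic elements and block equations -/

/-- Being quadratic with roots in `L` means satisfying a monic quadratic equation with
coefficients in `𝕜` whose roots lie in `L`. -/
theorem isQuadratic_iff_exists_mul_self {𝕜 L R : Type*} [Field 𝕜] [Field L] [Algebra 𝕜 L] [Ring R]
    [Algebra 𝕜 R] (T : R) :
    IsQuadratic 𝕜 L T ↔ ∃ s r : 𝕜, T * T = s • T - r • (1 : R) ∧
      ∃ a b : L, a + b = algebraMap 𝕜 L s ∧ a * b = algebraMap 𝕜 L r := by
  have expand : ∀ a b : L,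
      ((1 : L) ⊗ₜ[𝕜] T - a ⊗ₜ[𝕜] (1 : R)) * ((1 : L) ⊗ₜ[𝕜] T - b ⊗ₜ[𝕜] (1 : R)) =
        (1 : L) ⊗ₜ[𝕜] (T * T) - (a + b) ⊗ₜ[𝕜] T + (a * b) ⊗ₜ[𝕜] (1 : R) := by
    intro a b
    simp only [sub_mul, mul_sub, Algebra.TensorProduct.tmul_mul_tmul, one_mul, mul_one,
      TensorProduct.add_tmul]
    abel
  unfold IsQuadratic
  simp only [expand]
  constructor
  · rintro ⟨a, b, h⟩
    by_cases hT : ∃ t : 𝕜, T = t • (1 : R)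
    · obtain ⟨t, rfl⟩ := hT
      refine ⟨t + t, t * t, ?_, algebraMap 𝕜 L t, algebraMap 𝕜 L t, by simp, by simp⟩
      rw [smul_mul_smul_comm, one_mul, smul_smul, ← sub_smul]
      congr 1
      ring
    · push Not at hT
      have h1 : (1 : R) ≠ 0 := fun h1 => hT 0 (by rw [zero_smul, ← mul_one T, h1, mul_zero])
      obtain ⟨l, hl⟩ := Module.Projective.exists_dual_ne_zero 𝕜 (one_ne_zero : (1 : L) ≠ 0)
      -- A functional on `L` that does not vanish at `1` turns the equation into one over `𝕜`.
      have h2 := congrArg ((TensorProduct.lid 𝕜 R).toLinearMap ∘ₗ LinearMap.rTensor R l) h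
      simp only [map_add, map_sub, LinearMap.comp_apply, LinearMap.rTensor_tmul,
        LinearEquiv.coe_coe, TensorProduct.lid_tmul, LinearMap.map_zero] at h2
      have h3 : T * T = ((l 1)⁻¹ * (l a + l b)) • T - ((l 1)⁻¹ * l (a * b)) • (1 : R) := by
        have h4 : l 1 • (T * T) = (l a + l b) • T - l (a * b) • (1 : R) := by
          rw [← sub_eq_zero, ← h2]; abel
        rw [mul_smul, mul_smul, ← smul_sub, ← h4, smul_smul, inv_mul_cancel₀ hl, one_smul]
      refine ⟨_, _, h3, a, b, ?_⟩
      generalize (l 1)⁻¹ * (l a + l b) = s at h3 ⊢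
      generalize (l 1)⁻¹ * l (a * b) = r at h3 ⊢
      -- Functionals on `R` that separate `T` and `1` then compare the coefficients.
      have coeff : ∀ g : Module.Dual 𝕜 R,
          g T • (algebraMap 𝕜 L s - (a + b)) - g 1 • (algebraMap 𝕜 L r - a * b) = 0 := by
        intro g
        have h5 := congrArg ((TensorProduct.rid 𝕜 L).toLinearMap ∘ₗ LinearMap.lTensor L g) h
        simp only [map_add, map_sub, LinearMap.comp_apply, LinearMap.lTensor_tmul,
          LinearEquiv.coe_coe, TensorProduct.rid_tmul, LinearMap.map_zero, h3, map_smul] at h5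
        rw [← h5]
        simp only [Algebra.smul_def, map_sub, map_mul, Algebra.algebraMap_self, RingHom.id_apply]
        ring
      obtain ⟨g, hgT, hg⟩ := Submodule.exists_dual_map_eq_bot_of_notMem (p := 𝕜 ∙ (1 : R))
        (x := T) (fun hmem => by
          obtain ⟨c, hc⟩ := Submodule.mem_span_singleton.1 hmem
          exact hT c hc.symm) inferInstance
      have hg1 : g 1 = 0 := by
        have : g 1 ∈ (𝕜 ∙ (1 : R)).map g := ⟨1, Submodule.mem_span_singleton_self _, rfl⟩
        rwa [hg, Submodule.mem_bot] at this
      obtain ⟨g', hg'⟩ := Module.Projective.exists_dual_ne_zero 𝕜 h1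
      have hs := coeff g
      rw [hg1, zero_smul, sub_zero, smul_eq_zero_iff_right hgT] at hs
      have hr := coeff g'
      rw [hs, smul_zero, zero_sub, neg_eq_zero, smul_eq_zero_iff_right hg'] at hr
      exact ⟨(sub_eq_zero.1 hs).symm, (sub_eq_zero.1 hr).symm⟩
  · rintro ⟨s, r, h, a, b, hs, hr⟩
    refine ⟨a, b, ?_⟩
    rw [hs, hr, h, Algebra.algebraMap_eq_smul_one, Algebra.algebraMap_eq_smul_one,
      TensorProduct.smul_tmul, TensorProduct.smul_tmul, TensorProduct.tmul_sub]
    abel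

/-- The equation `M * M = s • M - r • 1` for the block matrix `M = !![T, S; U, V]`, written out
entry by entry. -/
def BlockQuadratic {𝕜 R : Type*} [Field 𝕜] [Ring R] [Algebra 𝕜 R] (s r : 𝕜) (T S U V : R) : Prop :=
  T * T + S * U = s • T - r • (1 : R) ∧ T * S + S * V = s • S ∧
    U * T + V * U = s • U ∧ U * S + V * V = s • V - r • (1 : R)

theorem blockQuadratic_iff {𝕜 R : Type*} [Field 𝕜] [Ring R] [Algebra 𝕜 R] (s r : 𝕜)
    (T S U V : R) : BlockQuadratic s r T S U V ↔
      !![T, S; U, V] * !![T, S; U, V] = s • !![T, S; U, V] - r • (1 : Matrix (Fin 2) (Fin 2) R) := by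
  simp [BlockQuadratic, Matrix.one_fin_two, and_assoc]

/-- `φ` sends the entries of every `2 × 2` block matrix that is quadratic with roots in `𝕜` to the
entries of a block matrix satisfying some quadratic equation over `𝕜`. This consequence of
`QuadraticPreserving 𝕜 L 2 φ` does not depend on `L`. -/
def PreservesBlockQuadratic (𝕜 : Type*) {R S : Type*} [Field 𝕜] [Ring R] [Algebra 𝕜 R] [Ring S]
    [Algebra 𝕜 S] (φ : R → S) : Prop :=
  ∀ (a b : 𝕜) (T S U V : R), BlockQuadratic (a + b) (a * b) T S U V →
    ∃ s r : 𝕜, BlockQuadratic s r (φ T) (φ S) (φ U) (φ V)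

theorem Matrix.fin_two_of_map {R S : Type*} (φ : R → S) (T₁ T₂ T₃ T₄ : R) :
    (!![T₁, T₂; T₃, T₄]).map φ = !![φ T₁, φ T₂; φ T₃, φ T₄] := by
  ext i j; fin_cases i <;> fin_cases j <;> rfl

section Algebra

variable {𝕜 L R S : Type*} [Field 𝕜] [Field L] [Algebra 𝕜 L] [Ring R] [Algebra 𝕜 R] [Ring S]
  [Algebra 𝕜 S]

theorem BlockQuadratic.isQuadratic {a b : 𝕜} {T₁ T₂ T₃ T₄ : R}
    (h : BlockQuadratic (a + b) (a * b) T₁ T₂ T₃ T₄) :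
    IsQuadratic 𝕜 L !![T₁, T₂; T₃, T₄] :=
  (isQuadratic_iff_exists_mul_self _).2 ⟨_, _, (blockQuadratic_iff _ _ _ _ _ _).1 h,
    algebraMap 𝕜 L a, algebraMap 𝕜 L b, by simp, by simp⟩

theorem IsQuadratic.exists_blockQuadratic {T₁ T₂ T₃ T₄ : R}
    (h : IsQuadratic 𝕜 L !![T₁, T₂; T₃, T₄]) : ∃ s r : 𝕜, BlockQuadratic s r T₁ T₂ T₃ T₄ := by
  obtain ⟨s, r, h, -⟩ := (isQuadratic_iff_exists_mul_self _).1 h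
  exact ⟨s, r, (blockQuadratic_iff _ _ _ _ _ _).2 h⟩

theorem QuadraticPreserving.preservesBlockQuadratic {φ : R → S}
    (h : QuadraticPreserving 𝕜 L 2 φ) : PreservesBlockQuadratic 𝕜 φ := by
  intro a b T₁ T₂ T₃ T₄ hT
  have := (h _).1 (hT.isQuadratic (L := L))
  rw [Matrix.fin_two_of_map] at this
  exact this.exists_blockQuadratic

theorem QuadraticPreserving.preservesBlockQuadratic_symm {φ : R ≃ S}
    (h : QuadraticPreserving 𝕜 L 2 φ) : PreservesBlockQuadratic 𝕜 φ.symm := by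
  intro a b T₁ T₂ T₃ T₄ hT
  refine IsQuadratic.exists_blockQuadratic (L := L) ((h _).2 ?_)
  rw [Matrix.fin_two_of_map]
  simpa using hT.isQuadratic (L := L)

theorem BlockQuadratic.smul {s r : 𝕜} {T₁ T₂ T₃ T₄ : R} (h : BlockQuadratic s r T₁ T₂ T₃ T₄)
    (c : 𝕜) : BlockQuadratic (c * s) (c ^ 2 * r) (c • T₁) (c • T₂) (c • T₃) (c • T₄) := by
  rw [blockQuadratic_iff] at h ⊢
  have e : !![c • T₁, c • T₂; c • T₃, c • T₄] = c • !![T₁, T₂; T₃, T₄] := by simp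
  rw [e, smul_mul_smul_comm, h, smul_sub, smul_smul, smul_smul, smul_smul]
  congr 2 <;> ring

/-! ### Scalars and multiples of idempotents -/

section Equiv

variable {φ : R ≃ S}

/-- For every `N` the block matrix `!![0, N; 0, 0]` squares to zero. Its image has an arbitrary upper
right entry, which forces `φ 0 = 0`. -/
theorem PreservesBlockQuadratic.map_zero [NeZero (2 : 𝕜)] (hφ : PreservesBlockQuadratic 𝕜 φ)
    (hS : ∃ N : S, ∀ c : 𝕜, N ≠ c • (1 : S)) : φ 0 = 0 := by
  have key : ∀ N : S, ∃ s r : 𝕜, BlockQuadratic s r (φ 0) N (φ 0) (φ 0) := by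
    intro N
    simpa using hφ 0 0 0 (φ.symm N) 0 0 (by simp [BlockQuadratic])
  -- The corner entry `1` shows that `φ 0` is a scalar.
  obtain ⟨s, r, -, h, -, -⟩ := key 1
  obtain ⟨w, hw⟩ : ∃ w : 𝕜, φ 0 = w • (1 : S) := by
    refine ⟨s / 2, ?_⟩
    rw [mul_one, one_mul, ← two_smul 𝕜] at h
    rw [div_eq_inv_mul, mul_smul, ← h, smul_smul, inv_mul_cancel₀ two_ne_zero, one_smul]
  obtain ⟨N, hN⟩ := hS
  obtain ⟨s, r, h, -⟩ := key N
  rw [hw] at h ⊢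
  by_cases hw0 : w = 0
  · simp [hw0]
  · refine absurd ?_ (hN (w⁻¹ * (s * w - r - w * w)))
    have h' : w • N = (s * w - r - w * w) • (1 : S) := by
      rw [smul_mul_smul_comm, mul_one, mul_smul_comm, mul_one, smul_smul] at h
      rw [sub_smul, sub_smul, ← h]
      abel
    rw [mul_smul, ← h', smul_smul, inv_mul_cancel₀ hw0, one_smul]

/-- Scalars go to scalars: the block matrix `!![c, N; 0, c]` is quadratic for every `N`, in particular
for the preimage `N` of `1`. -/
theorem PreservesBlockQuadratic.exists_map_smul_one [NeZero (2 : 𝕜)]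
    (hφ : PreservesBlockQuadratic 𝕜 φ) (c : 𝕜) :
    ∃ d : 𝕜, φ (c • 1) = d • (1 : S) := by
  obtain ⟨s, r, -, h, -, -⟩ := hφ c c (c • 1) (φ.symm 1) 0 (c • 1) (by
    simp [BlockQuadratic, add_smul, mul_smul])
  refine ⟨s / 2, ?_⟩
  rw [φ.apply_symm_apply, mul_one, one_mul, ← two_smul 𝕜] at h
  rw [div_eq_inv_mul, mul_smul, ← h, smul_smul, inv_mul_cancel₀ two_ne_zero, one_smul]

end Equiv

/-- Two quadratic equations satisfied by a non-scalar element coincide. -/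
theorem eq_and_eq_of_smul_sub_eq {T : R} (hT : ∀ c : 𝕜, T ≠ c • (1 : R)) {s r t q : 𝕜}
    (h : s • T - r • (1 : R) = t • T - q • (1 : R)) : s = t ∧ r = q := by
  have h1 : (s - t) • T = (r - q) • (1 : R) := by
    rw [sub_smul, sub_smul, sub_eq_sub_iff_add_eq_add]
    rw [sub_eq_sub_iff_add_eq_add] at h
    rw [h]; abel
  have hst : s = t := by
    by_contra hne
    refine hT ((s - t)⁻¹ * (r - q)) ?_
    rw [mul_smul, ← h1, smul_smul, inv_mul_cancel₀ (sub_ne_zero.2 hne), one_smul]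
  refine ⟨hst, ?_⟩
  by_contra hne
  rw [hst, sub_self, zero_smul] at h1
  have h2 : (1 : R) = 0 := by
    rw [← one_smul 𝕜 (1 : R), ← inv_mul_cancel₀ (sub_ne_zero.2 hne), mul_smul, ← h1, smul_zero]
  exact hT 0 (by rw [zero_smul, ← mul_one T, h2, mul_zero])

/-- A bijection which, together with its inverse, respects quadratic block matrices, and which acts
on scalar multiples of the identity through a permutation `h` of the scalars fixing `0` and `1`. -/
structure IsNormalizedPreserver (φ : R ≃ S) (h : 𝕜 ≃ 𝕜) : Prop where
  preserves : PreservesBlockQuadratic 𝕜 φ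
  preserves_symm : PreservesBlockQuadratic 𝕜 φ.symm
  map_zero : φ 0 = 0
  map_smul_one : ∀ c, φ (c • 1) = h c • (1 : S)
  scalar_zero : h 0 = 0
  scalar_one : h 1 = 1

/-- A bijection respecting quadratic block matrices in both directions becomes normalized when
divided by the scalar to which it sends the identity. -/
theorem exists_isNormalizedPreserver [NeZero (2 : 𝕜)] {φ : R ≃ S}
    (hφ : PreservesBlockQuadratic 𝕜 φ) (hφ' : PreservesBlockQuadratic 𝕜 φ.symm)
    (hS : ∃ N : S, ∀ c : 𝕜, N ≠ c • (1 : S)) [Nontrivial R] :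
    ∃ (c : 𝕜) (ψ : R ≃ S) (h : 𝕜 ≃ 𝕜), IsNormalizedPreserver ψ h ∧ ∀ T, φ T = c • ψ T := by
  have h0 : φ 0 = 0 := hφ.map_zero hS
  have : Nontrivial S := φ.symm.nontrivial
  choose h hh using hφ.exists_map_smul_one
  choose k hk using hφ'.exists_map_smul_one
  have hkh : ∀ a, k (h a) = a := fun a => smul_left_injective 𝕜 (one_ne_zero (α := R)) (by
    dsimp only;  rw [← hk, ← hh, φ.symm_apply_apply])
  have hhk : ∀ a, h (k a) = a := fun a => smul_left_injective 𝕜 (one_ne_zero (α := S)) (by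
    dsimp only;  rw [← hh, ← hk, φ.apply_symm_apply])
  have hh0 : h 0 = 0 := smul_left_injective 𝕜 (one_ne_zero (α := S)) (by
    dsimp only;  rw [← hh, zero_smul, zero_smul, h0])
  have hc : h 1 ≠ 0 := fun e => one_ne_zero (α := 𝕜) (by
    rw [← hkh 1, ← hkh 0, e, hh0])
  let u : 𝕜ˣ := (Units.mk0 (h 1) hc)⁻¹
  have hu : ∀ T : S, u • T = (h 1)⁻¹ • T := fun T => by simp [u, Units.smul_def]
  have hu' : ∀ T : S, u⁻¹ • T = h 1 • T := fun T => by simp [u, Units.smul_def]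
  refine ⟨h 1, φ.trans (MulAction.toPerm u), (Equiv.mk h k hkh hhk).trans (MulAction.toPerm u),
    ⟨?_, ?_, ?_, ?_, ?_, ?_⟩, ?_⟩
  · intro a b T₁ T₂ T₃ T₄ hT
    obtain ⟨s, r, H⟩ := hφ a b T₁ T₂ T₃ T₄ hT
    exact ⟨_, _, by simpa only [Equiv.trans_apply, MulAction.toPerm_apply, hu] using H.smul (h 1)⁻¹⟩
  · intro a b T₁ T₂ T₃ T₄ hT
    have H := hT.smul (h 1)
    rw [show h 1 * (a + b) = h 1 * a + h 1 * b by ring,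
      show h 1 ^ 2 * (a * b) = h 1 * a * (h 1 * b) by ring] at H
    simpa only [Equiv.symm_trans_apply, MulAction.toPerm_symm_apply, hu'] using hφ' _ _ _ _ _ _ H
  · simp [h0]
  · intro c
    simp [hh, Units.smul_def, mul_smul]
  · simp [hh0]
  · simp [u, Units.smul_def, hc]
  · intro T
    simp [hu, smul_smul, mul_inv_cancel₀ hc]

namespace IsNormalizedPreserver

variable {φ : R ≃ S} {h : 𝕜 ≃ 𝕜}

theorem symm (H : IsNormalizedPreserver φ h) : IsNormalizedPreserver φ.symm h.symm where
  preserves := H.preserves_symm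
  preserves_symm := H.preserves
  map_zero := by rw [Equiv.symm_apply_eq, H.map_zero]
  map_smul_one c := by rw [Equiv.symm_apply_eq, H.map_smul_one, h.apply_symm_apply]
  scalar_zero := by rw [Equiv.symm_apply_eq, H.scalar_zero]
  scalar_one := by rw [Equiv.symm_apply_eq, H.scalar_one]

theorem scalar_eq_zero_iff (H : IsNormalizedPreserver φ h) {a : 𝕜} : h a = 0 ↔ a = 0 := by
  rw [← h.injective.eq_iff (a := a), H.scalar_zero]

theorem map_eq_zero_iff (H : IsNormalizedPreserver φ h) {T : R} : φ T = 0 ↔ T = 0 := by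
  rw [← φ.injective.eq_iff (a := T), H.map_zero]

theorem map_ne_smul_one (H : IsNormalizedPreserver φ h) {T : R} (hT : ∀ c : 𝕜, T ≠ c • (1 : R))
    (c : 𝕜) : φ T ≠ c • (1 : S) := fun e => hT (h.symm c) <| φ.injective <| by
  rw [e, H.map_smul_one, h.apply_symm_apply]

/-- Non-scalar elements proportional to their square are preserved: the block matrix with all
entries equal to `T` detects them. The factor transforms through `h` if it is nonzero, since
`diag (T, a)` is quadratic. -/
theorem exists_map_mul_self [NeZero (2 : 𝕜)] (H : IsNormalizedPreserver φ h) {T : R}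
    (hT : ∀ c : 𝕜, T ≠ c • (1 : R)) {a : 𝕜} (hTa : T * T = a • T) :
    ∃ t, φ T * φ T = t • φ T ∧ (a ≠ 0 → t = h a) := by
  obtain ⟨s, r, -, h1, -, -⟩ := H.preserves (a + a) 0 T T T T (by
    simp [BlockQuadratic, hTa, add_smul])
  obtain ⟨p, q, h2, -, -, h3⟩ := H.preserves a 0 T 0 0 (a • 1) (by
    simp [BlockQuadratic, hTa])
  have ht : φ T * φ T = (s / 2) • φ T := by
    rw [← two_smul 𝕜] at h1
    rw [div_eq_inv_mul, mul_smul, ← h1, smul_smul, inv_mul_cancel₀ two_ne_zero, one_smul]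
  refine ⟨s / 2, ht, fun ha => ?_⟩
  have hT' := H.map_ne_smul_one hT
  obtain ⟨hsp, rfl⟩ := eq_and_eq_of_smul_sub_eq hT' (s := s / 2) (r := 0) (t := p) (q := q)
    (by simpa [H.map_zero, ht] using h2)
  have h1S : (1 : S) ≠ 0 := fun e => hT' 0 (by rw [zero_smul, ← mul_one (φ T), e, mul_zero])
  have h4 : (h a * h a) • (1 : S) = (p * h a) • (1 : S) := by
    simpa [H.map_zero, H.map_smul_one, smul_smul] using h3
  have h5 := smul_left_injective 𝕜 h1S h4
  rw [hsp]
  exact (mul_right_cancel₀ (mt H.scalar_eq_zero_iff.1 ha) h5).symm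

theorem map_mul_self [NeZero (2 : 𝕜)] (H : IsNormalizedPreserver φ h) {T : R}
    (hT : ∀ c : 𝕜, T ≠ c • (1 : R)) {a : 𝕜} (hTa : T * T = a • T) :
    φ T * φ T = h a • φ T := by
  obtain ⟨t, ht, hta⟩ := H.exists_map_mul_self hT hTa
  by_cases ha : a = 0
  · by_cases ht0 : t = 0
    · rw [ht, ht0, ha, H.scalar_zero]
    · -- If `T * T = 0` but `t ≠ 0`, then `T` would also satisfy an equation with nonzero factor.
      obtain ⟨t', ht', hta'⟩ := H.symm.exists_map_mul_self (H.map_ne_smul_one hT) ht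
      rw [φ.symm_apply_apply, hTa, ha, zero_smul, eq_comm, smul_eq_zero_iff_right
        (by rw [hta' ht0]; exact mt H.symm.scalar_eq_zero_iff.1 ht0)] at ht'
      exact absurd (by rw [ht', zero_smul]) (hT 0)
  · rw [ht, hta ha]

theorem isIdempotentElem_map [NeZero (2 : 𝕜)] (H : IsNormalizedPreserver φ h) {E : R}
    (hE' : ∀ c : 𝕜, E ≠ c • (1 : R)) (hE : E * E = E) : φ E * φ E = φ E := by
  simpa [H.scalar_one] using H.map_mul_self hE' (a := 1) (by simpa using hE)

/-- For an idempotent `E`, the relation `E * T = T` means that `!![E, T; 0, 0]` is idempotent. -/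
theorem map_mul_eq_of_mul_eq [NeZero (2 : 𝕜)] (H : IsNormalizedPreserver φ h) {E T : R}
    (hE : E * E = E) (hE' : ∀ c : 𝕜, E ≠ c • (1 : R)) (hT : E * T = T) : φ E * φ T = φ T := by
  obtain ⟨s, r, h1, h2, -⟩ := H.preserves 1 0 E T 0 0 (by simp [BlockQuadratic, hE, hT])
  have h3 := H.isIdempotentElem_map hE' hE
  rw [H.map_zero, mul_zero, add_zero, h3] at h1
  obtain ⟨rfl, -⟩ := eq_and_eq_of_smul_sub_eq (H.map_ne_smul_one hE') (s := 1) (r := 0) (t := s)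
    (q := r) (by simpa using h1)
  simpa [H.map_zero] using h2

/-- For an idempotent `E`, the relation `T * E = T` means that `!![E, 0; T, 0]` is idempotent. -/
theorem map_mul_eq_of_mul_eq' [NeZero (2 : 𝕜)] (H : IsNormalizedPreserver φ h) {E T : R}
    (hE : E * E = E) (hE' : ∀ c : 𝕜, E ≠ c • (1 : R)) (hT : T * E = T) : φ T * φ E = φ T := by
  obtain ⟨s, r, h1, -, h2, -⟩ := H.preserves 1 0 E 0 T 0 (by simp [BlockQuadratic, hE, hT])
  have h3 := H.isIdempotentElem_map hE' hE
  rw [H.map_zero, zero_mul, add_zero, h3] at h1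
  obtain ⟨rfl, -⟩ := eq_and_eq_of_smul_sub_eq (H.map_ne_smul_one hE') (s := 1) (r := 0) (t := s)
    (q := r) (by simpa using h1)
  simpa [H.map_zero] using h2

end IsNormalizedPreserver

end Algebra

/-! ### Rank-one operators in a standard operator algebra -/

section RankOne

variable {𝕜 X : Type*} [RCLike 𝕜] [NormedAddCommGroup X] [NormedSpace 𝕜 X]
  {𝒜 : Subalgebra 𝕜 (X →L[𝕜] X)}

namespace IsStandardOperatorAlgebra

/-- The operator `z ↦ f z • x` as an element of a standard operator algebra. -/
def rankOne (h𝒜 : IsStandardOperatorAlgebra 𝒜) (x : X) (f : StrongDual 𝕜 X) : 𝒜 :=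
  ⟨f.smulRight x, h𝒜.finiteRank_mem _ <|
    Submodule.finiteDimensional_of_le (S₂ := 𝕜 ∙ x) <| by
      rintro _ ⟨z, rfl⟩
      exact Submodule.smul_mem _ _ (Submodule.mem_span_singleton_self x)⟩

variable (h𝒜 : IsStandardOperatorAlgebra 𝒜)

@[simp]
theorem rankOne_apply (x : X) (f : StrongDual 𝕜 X) (z : X) :
    (h𝒜.rankOne x f : X →L[𝕜] X) z = f z • x := rfl

theorem rankOne_mul_rankOne (x z : X) (f g : StrongDual 𝕜 X) :
    h𝒜.rankOne x f * h𝒜.rankOne z g = f z • h𝒜.rankOne x g := by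
  ext w
  simp [smul_smul, mul_comm]

theorem mul_rankOne (T : 𝒜) (x : X) (f : StrongDual 𝕜 X) :
    T * h𝒜.rankOne x f = h𝒜.rankOne ((T : X →L[𝕜] X) x) f := by
  ext w
  simp

theorem rankOne_mul (T : 𝒜) (x : X) (f : StrongDual 𝕜 X) :
    h𝒜.rankOne x f * T = h𝒜.rankOne x (f ∘L (T : X →L[𝕜] X)) := by
  ext w
  simp

theorem smul_rankOne (c : 𝕜) (x : X) (f : StrongDual 𝕜 X) :
    c • h𝒜.rankOne x f = h𝒜.rankOne (c • x) f := by
  ext w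
  simp [smul_comm c]

theorem smul_rankOne' (c : 𝕜) (x : X) (f : StrongDual 𝕜 X) :
    c • h𝒜.rankOne x f = h𝒜.rankOne x (c • f) := by
  ext w
  simp [smul_smul]

theorem rankOne_eq_zero_iff {x : X} {f : StrongDual 𝕜 X} :
    h𝒜.rankOne x f = 0 ↔ x = 0 ∨ f = 0 := by
  constructor
  · intro h
    rw [or_iff_not_imp_left]
    intro hx
    ext z
    have := congrArg (fun T : 𝒜 => (T : X →L[𝕜] X) z) h
    simpa [hx] using this
  · rintro (rfl | rfl) <;> ext <;> simp

theorem rankOne_left_injective {f : StrongDual 𝕜 X} (hf : f ≠ 0) {x x' : X}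
    (h : h𝒜.rankOne x f = h𝒜.rankOne x' f) : x = x' := by
  obtain ⟨z, hz⟩ := DFunLike.ne_iff.1 hf
  have := congrArg (fun T : 𝒜 => (T : X →L[𝕜] X) z) h
  exact smul_right_injective X hz (by simpa using this)

theorem rankOne_right_injective {x : X} (hx : x ≠ 0) {f f' : StrongDual 𝕜 X}
    (h : h𝒜.rankOne x f = h𝒜.rankOne x f') : f = f' := by
  ext z
  have := congrArg (fun T : 𝒜 => (T : X →L[𝕜] X) z) h
  exact smul_left_injective 𝕜 hx (by simpa using this)

/-- Two equal nonzero rank-one operators have proportional functionals. -/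
theorem exists_smul_eq_of_rankOne_eq {x x' : X} {f f' : StrongDual 𝕜 X} (hx : x ≠ 0)
    (h : h𝒜.rankOne x f = h𝒜.rankOne x' f') : ∃ c : 𝕜, f = c • f' := by
  obtain ⟨g, hg⟩ := SeparatingDual.exists_eq_one (R := 𝕜) hx
  refine ⟨g x', ?_⟩
  ext z
  have := congrArg (fun T : 𝒜 => g ((T : X →L[𝕜] X) z)) h
  simpa [hg, mul_comm] using this

/-- Two equal nonzero rank-one operators have proportional ranges. -/
theorem exists_smul_eq_of_rankOne_eq' {x x' : X} {f f' : StrongDual 𝕜 X} (hf : f ≠ 0)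
    (h : h𝒜.rankOne x f = h𝒜.rankOne x' f') : ∃ c : 𝕜, x = c • x' := by
  obtain ⟨z, hz⟩ := DFunLike.ne_iff.1 hf
  refine ⟨(f z)⁻¹ * f' z, ?_⟩
  have := congrArg (fun T : 𝒜 => (T : X →L[𝕜] X) z) h
  rw [mul_smul, ← show f z • x = f' z • x' by simpa using this, smul_smul,
    inv_mul_cancel₀ hz, one_smul]

theorem eq_zero_of_rankOne_eq_smul_one (hX : ¬ FiniteDimensional 𝕜 X) {x : X}
    {f : StrongDual 𝕜 X} {c : 𝕜} (h : h𝒜.rankOne x f = c • 1) : c = 0 := by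
  by_contra hc
  refine hX (FiniteDimensional.of_surjective (LinearMap.toSpanSingleton 𝕜 X x) fun z => ?_)
  have := congrArg (fun T : 𝒜 => (T : X →L[𝕜] X) z) h
  refine ⟨c⁻¹ * f z, ?_⟩
  have h' : f z • x = c • z := by simpa using this
  rw [LinearMap.toSpanSingleton_apply, mul_smul, h', smul_smul, inv_mul_cancel₀ hc, one_smul]

theorem rankOne_ne_smul_one (hX : ¬ FiniteDimensional 𝕜 X) {x : X} {f : StrongDual 𝕜 X}
    (hx : x ≠ 0) (hf : f ≠ 0) (c : 𝕜) : h𝒜.rankOne x f ≠ c • 1 := by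
  intro h
  have hc := h𝒜.eq_zero_of_rankOne_eq_smul_one hX h
  rw [hc, zero_smul, h𝒜.rankOne_eq_zero_iff] at h
  exact h.elim hx hf

end IsStandardOperatorAlgebra

theorem exists_dual_eq_one_of_ne_zero {f : StrongDual 𝕜 X} (hf : f ≠ 0) : ∃ x, f x = 1 := by
  obtain ⟨z, hz⟩ := DFunLike.ne_iff.1 hf
  exact ⟨(f z)⁻¹ • z, by simpa using inv_mul_cancel₀ hz⟩

theorem ne_zero_and_ne_zero_of_dual_eq_one {x : X} {f : StrongDual 𝕜 X} (h : f x = 1) :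
    x ≠ 0 ∧ f ≠ 0 :=
  ⟨by rintro rfl; simp at h, by rintro rfl; simp at h⟩

end RankOne

/-! ### The action on rank-one operators -/

namespace IsNormalizedPreserver

variable {𝕜 X Y : Type*} [RCLike 𝕜] [NormedAddCommGroup X] [NormedSpace 𝕜 X]
  [NormedAddCommGroup Y] [NormedSpace 𝕜 Y]
  {𝒜 : Subalgebra 𝕜 (X →L[𝕜] X)} {ℬ : Subalgebra 𝕜 (Y →L[𝕜] Y)} {φ : 𝒜 ≃ ℬ} {h : 𝕜 ≃ 𝕜}

/-- The rank-one idempotents are the minimal nonzero idempotents, so they are preserved. -/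
theorem exists_map_rankOne_idempotent (H : IsNormalizedPreserver φ h)
    (h𝒜 : IsStandardOperatorAlgebra 𝒜) (hℬ : IsStandardOperatorAlgebra ℬ)
    (hX : ¬ FiniteDimensional 𝕜 X) (hY : ¬ FiniteDimensional 𝕜 Y)
    {x : X} {f : StrongDual 𝕜 X} (hfx : f x = 1) :
    ∃ (y : Y) (g : StrongDual 𝕜 Y), g y = 1 ∧ φ (h𝒜.rankOne x f) = hℬ.rankOne y g := by
  obtain ⟨hx, hf⟩ := ne_zero_and_ne_zero_of_dual_eq_one hfx
  have hE : h𝒜.rankOne x f * h𝒜.rankOne x f = h𝒜.rankOne x f := by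
    rw [h𝒜.rankOne_mul_rankOne, hfx, one_smul]
  have hne := h𝒜.rankOne_ne_smul_one hX hx hf
  have hE' := H.isIdempotentElem_map hne hE
  have hne' := H.map_ne_smul_one hne
  obtain ⟨w, hw⟩ : ∃ w, (φ (h𝒜.rankOne x f) : Y →L[𝕜] Y) w ≠ 0 := by
    by_contra! hw
    exact hne' 0 (by ext w; simp [hw w])
  set E' := φ (h𝒜.rankOne x f) with hE'_def
  set y := (E' : Y →L[𝕜] Y) w
  have hEy : (E' : Y →L[𝕜] Y) y = y :=
    congrArg (fun T : ℬ => (T : Y →L[𝕜] Y) w) hE'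
  obtain ⟨g, hg⟩ := SeparatingDual.exists_eq_one (R := 𝕜) hw
  have hgy : (g ∘L (E' : Y →L[𝕜] Y)) y = 1 := by simp [hEy, hg]
  refine ⟨y, g ∘L (E' : Y →L[𝕜] Y), hgy, ?_⟩
  -- The rank-one idempotent `F'` below `E'` is the image of an idempotent `F` below the minimal
  -- idempotent `x ⊗ f`, so `F = x ⊗ f`.
  set F' := hℬ.rankOne y (g ∘L (E' : Y →L[𝕜] Y)) with hF'_def
  have hF'F' : F' * F' = F' := by rw [hF'_def, hℬ.rankOne_mul_rankOne, hgy, one_smul]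
  have hF'ne := hℬ.rankOne_ne_smul_one hY (ne_zero_and_ne_zero_of_dual_eq_one hgy).1
    (ne_zero_and_ne_zero_of_dual_eq_one hgy).2
  have h1 : E' * F' = F' := by rw [hF'_def, hℬ.mul_rankOne, hEy]
  have h2 : F' * E' = F' := by
    rw [hF'_def, hℬ.rankOne_mul, ContinuousLinearMap.comp_assoc]
    congr 2
    exact congrArg Subtype.val hE'
  have h3 := H.symm.map_mul_eq_of_mul_eq hE' hne' h1
  have h4 := H.symm.map_mul_eq_of_mul_eq' hE' hne' h2
  have h5 := H.symm.isIdempotentElem_map hF'ne hF'F'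
  rw [hE'_def, φ.symm_apply_apply] at h3 h4
  -- `F = (x ⊗ f) * F * (x ⊗ f)` is a multiple of `x ⊗ f`.
  set F := φ.symm F'
  obtain ⟨t, ht⟩ : ∃ t : 𝕜, F = t • h𝒜.rankOne x f :=
    ⟨f ((F : X →L[𝕜] X) x), by
      rw [← h𝒜.rankOne_mul_rankOne, ← h𝒜.mul_rankOne, h4, h3]⟩
  have hF0 : F ≠ 0 := fun h0 => hF'ne 0 <| by
    rw [zero_smul]; exact H.symm.map_eq_zero_iff.1 h0
  have ht0 : t ≠ 0 := by rintro rfl; exact hF0 (by rw [ht, zero_smul])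
  rw [ht, smul_mul_smul_comm, hE] at h5
  have ht1 : t * t = t := smul_left_injective 𝕜 (show h𝒜.rankOne x f ≠ 0 from
    fun h0 => hne 0 (by rw [h0, zero_smul])) (by simpa using h5)
  rw [mul_eq_left₀ ht0] at ht1
  rw [ht1, one_smul] at ht
  rw [hE'_def, ← ht, φ.apply_symm_apply]

/-- The range of the image of `x ⊗ f` depends only on `x`. -/
theorem exists_map_rankOne_left (H : IsNormalizedPreserver φ h)
    (h𝒜 : IsStandardOperatorAlgebra 𝒜) (hℬ : IsStandardOperatorAlgebra ℬ)
    (hX : ¬ FiniteDimensional 𝕜 X) (hY : ¬ FiniteDimensional 𝕜 Y) {x : X} (hx : x ≠ 0) :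
    ∃ y : Y, ∀ f : StrongDual 𝕜 X, ∃ g, φ (h𝒜.rankOne x f) = hℬ.rankOne y g := by
  obtain ⟨e, he⟩ := SeparatingDual.exists_eq_one (R := 𝕜) hx
  obtain ⟨y, k, -, hk⟩ := H.exists_map_rankOne_idempotent h𝒜 hℬ hX hY he
  refine ⟨y, fun f => ?_⟩
  have h1 := H.map_mul_eq_of_mul_eq (E := h𝒜.rankOne x e) (T := h𝒜.rankOne x f)
    (by rw [h𝒜.rankOne_mul_rankOne, he, one_smul])
    (h𝒜.rankOne_ne_smul_one hX hx (ne_zero_and_ne_zero_of_dual_eq_one he).2)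
    (by rw [h𝒜.rankOne_mul_rankOne, he, one_smul])
  exact ⟨_, by rw [← h1, hk, hℬ.rankOne_mul]⟩

/-- The kernel of the image of `x ⊗ f` depends only on `f`. -/
theorem exists_map_rankOne_right (H : IsNormalizedPreserver φ h)
    (h𝒜 : IsStandardOperatorAlgebra 𝒜) (hℬ : IsStandardOperatorAlgebra ℬ)
    (hX : ¬ FiniteDimensional 𝕜 X) (hY : ¬ FiniteDimensional 𝕜 Y) {f : StrongDual 𝕜 X}
    (hf : f ≠ 0) : ∃ g : StrongDual 𝕜 Y, ∀ x : X, ∃ y, φ (h𝒜.rankOne x f) = hℬ.rankOne y g := by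
  obtain ⟨e, he⟩ := exists_dual_eq_one_of_ne_zero hf
  obtain ⟨y, k, -, hk⟩ := H.exists_map_rankOne_idempotent h𝒜 hℬ hX hY he
  refine ⟨k, fun x => ?_⟩
  have h1 := H.map_mul_eq_of_mul_eq' (E := h𝒜.rankOne e f) (T := h𝒜.rankOne x f)
    (by rw [h𝒜.rankOne_mul_rankOne, he, one_smul])
    (h𝒜.rankOne_ne_smul_one hX (ne_zero_and_ne_zero_of_dual_eq_one he).1 hf)
    (by rw [h𝒜.rankOne_mul_rankOne, he, one_smul])
  exact ⟨_, by rw [← h1, hk, hℬ.mul_rankOne]⟩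

/-- Applying the preserver to the rank-one block matrix `(xᵢ ⊗ fⱼ)` shows that the coefficients
of its image form a singular `2 × 2` matrix. -/
theorem coeff_mul_coeff_eq (H : IsNormalizedPreserver φ h)
    (h𝒜 : IsStandardOperatorAlgebra 𝒜) (hℬ : IsStandardOperatorAlgebra ℬ)
    (hY : ¬ FiniteDimensional 𝕜 Y) {x₁ x₂ : X} {f₁ f₂ : StrongDual 𝕜 X} {y₁ y₂ : Y}
    {g₁ g₂ : StrongDual 𝕜 Y} {c₁₁ c₁₂ c₂₁ c₂₂ : 𝕜}
    (h₁₁ : φ (h𝒜.rankOne x₁ f₁) = c₁₁ • hℬ.rankOne y₁ g₁)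
    (h₁₂ : φ (h𝒜.rankOne x₁ f₂) = c₁₂ • hℬ.rankOne y₁ g₂)
    (h₂₁ : φ (h𝒜.rankOne x₂ f₁) = c₂₁ • hℬ.rankOne y₂ g₁)
    (h₂₂ : φ (h𝒜.rankOne x₂ f₂) = c₂₂ • hℬ.rankOne y₂ g₂)
    (hc : c₂₁ ≠ 0) (hy : y₂ ≠ 0) (hg₁ : g₁ ≠ 0) (hg₂ : g₂ ≠ 0) (hgy : g₁ y₁ ≠ 0) :
    c₁₁ * c₂₂ = c₁₂ * c₂₁ := by
  obtain ⟨s, r, -, -, h3, h4⟩ := H.preserves (f₁ x₁ + f₂ x₂) 0 (h𝒜.rankOne x₁ f₁)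
    (h𝒜.rankOne x₁ f₂) (h𝒜.rankOne x₂ f₁) (h𝒜.rankOne x₂ f₂)
    (by simp [BlockQuadratic, h𝒜.rankOne_mul_rankOne, add_smul])
  rw [h₁₁, h₂₁, h₂₂, smul_mul_smul_comm, smul_mul_smul_comm, hℬ.rankOne_mul_rankOne,
    hℬ.rankOne_mul_rankOne, smul_smul, smul_smul, smul_smul, ← add_smul] at h3
  rw [h₁₂, h₂₁, h₂₂, smul_mul_smul_comm, smul_mul_smul_comm, hℬ.rankOne_mul_rankOne,
    hℬ.rankOne_mul_rankOne, smul_smul, smul_smul, smul_smul, ← add_smul, eq_sub_iff_add_eq,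
    ← eq_sub_iff_add_eq', ← sub_smul] at h4
  have hr : r = 0 := hℬ.eq_zero_of_rankOne_eq_smul_one hY
    (by rw [h4, hℬ.smul_rankOne])
  rw [hr, zero_smul, eq_comm, smul_eq_zero_iff_left
    (mt hℬ.rankOne_eq_zero_iff.1 (not_or.2 ⟨hy, hg₂⟩))] at h4
  have h3' := smul_left_injective 𝕜 (mt hℬ.rankOne_eq_zero_iff.1 (not_or.2 ⟨hy, hg₁⟩)) h3
  have : (c₂₁ * g₁ y₁) * (c₁₁ * c₂₂ - c₁₂ * c₂₁) = 0 := by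
    linear_combination c₂₂ * h3' + c₂₁ * h4
  exact sub_eq_zero.1 ((mul_eq_zero.1 this).resolve_left (mul_ne_zero hc hgy))

/-- The action on rank-one operators factors as `x ⊗ f ↦ u x ⊗ v f`. -/
theorem exists_map_rankOne (H : IsNormalizedPreserver φ h)
    (h𝒜 : IsStandardOperatorAlgebra 𝒜) (hℬ : IsStandardOperatorAlgebra ℬ)
    (hX : ¬ FiniteDimensional 𝕜 X) (hY : ¬ FiniteDimensional 𝕜 Y) :
    ∃ (u : X → Y) (v : StrongDual 𝕜 X → StrongDual 𝕜 Y),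
      ∀ x f, φ (h𝒜.rankOne x f) = hℬ.rankOne (u x) (v f) := by
  choose! a ha using fun x : X => H.exists_map_rankOne_left h𝒜 hℬ hX hY (x := x)
  choose! b hb using fun f : StrongDual 𝕜 X => H.exists_map_rankOne_right h𝒜 hℬ hX hY (f := f)
  have hne : ∀ {x f}, x ≠ 0 → f ≠ 0 → φ (h𝒜.rankOne x f) ≠ 0 := fun hx hf =>
    mt H.map_eq_zero_iff.1 (mt h𝒜.rankOne_eq_zero_iff.1 (not_or.2 ⟨hx, hf⟩))
  have hc : ∀ x f, ∃ c : 𝕜, x ≠ 0 → f ≠ 0 → φ (h𝒜.rankOne x f) = c • hℬ.rankOne (a x) (b f) := by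
    intro x f
    by_cases hx : x = 0
    · exact ⟨0, fun h => absurd hx h⟩
    by_cases hf : f = 0
    · exact ⟨0, fun _ h => absurd hf h⟩
    obtain ⟨g, hg⟩ := ha x hx f
    obtain ⟨y, hy⟩ := hb f hf x
    have hax : a x ≠ 0 := by
      intro h0
      exact hne hx hf (by rw [hg, hℬ.rankOne_eq_zero_iff]; exact Or.inl h0)
    obtain ⟨c, hc⟩ := hℬ.exists_smul_eq_of_rankOne_eq hax (hg.symm.trans hy)
    exact ⟨c, fun _ _ => by rw [hg, hc, hℬ.smul_rankOne']⟩
  choose c hc using hc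
  have : Nontrivial X := by
    by_contra hX'
    rw [not_nontrivial_iff_subsingleton] at hX'
    exact hX inferInstance
  obtain ⟨x₀, hx₀⟩ := exists_ne (0 : X)
  obtain ⟨f₀, hf₀⟩ := SeparatingDual.exists_eq_one (R := 𝕜) hx₀
  have hf₀' := (ne_zero_and_ne_zero_of_dual_eq_one hf₀).2
  have hne' : ∀ {x f}, x ≠ 0 → f ≠ 0 → c x f ≠ 0 ∧ a x ≠ 0 ∧ b f ≠ 0 := by
    intro x f hx hf
    have := hne hx hf
    rw [hc x f hx hf, Ne, smul_eq_zero, hℬ.rankOne_eq_zero_iff, not_or, not_or] at this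
    exact this
  have hba : b f₀ (a x₀) ≠ 0 := by
    have h1 := H.isIdempotentElem_map (h𝒜.rankOne_ne_smul_one hX hx₀ hf₀')
      (by rw [h𝒜.rankOne_mul_rankOne, hf₀, one_smul])
    intro h0
    rw [hc _ _ hx₀ hf₀', smul_mul_smul_comm, hℬ.rankOne_mul_rankOne, h0, zero_smul, smul_zero,
      ← hc _ _ hx₀ hf₀'] at h1
    exact hne hx₀ hf₀' h1.symm
  classical
  refine ⟨fun x => if x = 0 then 0 else (c x f₀ / c x₀ f₀) • a x,
    fun f => if f = 0 then 0 else c x₀ f • b f, fun x f => ?_⟩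
  dsimp only
  by_cases hx : x = 0
  · rw [if_pos hx, H.map_eq_zero_iff.2 (h𝒜.rankOne_eq_zero_iff.2 (Or.inl hx)), eq_comm,
      hℬ.rankOne_eq_zero_iff]
    exact Or.inl rfl
  by_cases hf : f = 0
  · rw [if_pos hf, H.map_eq_zero_iff.2 (h𝒜.rankOne_eq_zero_iff.2 (Or.inr hf)), eq_comm,
      hℬ.rankOne_eq_zero_iff]
    exact Or.inr rfl
  rw [if_neg hx, if_neg hf, hc x f hx hf, ← hℬ.smul_rankOne, ← hℬ.smul_rankOne', smul_smul]
  congr 1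
  have h1 := H.coeff_mul_coeff_eq h𝒜 hℬ hY (hc _ _ hx₀ hf₀') (hc _ _ hx₀ hf) (hc _ _ hx hf₀')
    (hc _ _ hx hf) (hne' hx hf₀').1 (hne' hx hf).2.1 (hne' hx hf₀').2.2 (hne' hx hf).2.2 hba
  have h2 := (hne' hx₀ hf₀').1
  field_simp
  linear_combination h1

end IsNormalizedPreserver

/-! ### Semilinearity -/

section Dual

variable {𝕜 X : Type*} [RCLike 𝕜] [NormedAddCommGroup X] [NormedSpace 𝕜 X]

/-- A continuous functional can be prescribed on finitely many linearly independent vectors. -/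
theorem LinearIndependent.exists_dual_apply_eq {ι : Type*} [Fintype ι] {x : ι → X}
    (hx : LinearIndependent 𝕜 x) (c : ι → 𝕜) : ∃ f : StrongDual 𝕜 X, ∀ i, f (x i) = c i := by
  classical
  have hinj : Function.Injective (Fintype.linearCombination 𝕜 x) :=
    hx.fintypeLinearCombination_injective
  obtain ⟨f, hf⟩ := SeparatingDual.dualMap_surjective_iff.2 hinj (Fintype.linearCombination 𝕜 c)
  refine ⟨f, fun i => ?_⟩
  have := congrArg (fun l : (ι → 𝕜) →ₗ[𝕜] 𝕜 => l (Pi.single i 1)) hf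
  simpa [Fintype.linearCombination_apply_single] using this

theorem exists_linearIndependent_nat (hX : ¬ FiniteDimensional 𝕜 X) :
    ∃ x : ℕ → X, LinearIndependent 𝕜 x := by
  have b := Module.Basis.ofVectorSpace 𝕜 X
  have : Infinite (Module.Basis.ofVectorSpaceIndex 𝕜 X) := by
    by_contra hfin
    rw [not_infinite_iff_finite] at hfin
    exact hX (Module.Finite.of_basis b)
  exact ⟨_, b.linearIndependent.comp _ (Infinite.natEmbedding _).injective⟩

end Dual

/-- A bijection between operator algebras acts on rank-one operators by `x ⊗ f ↦ u x ⊗ v f`, where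
`u` and `v` are bijective respectively surjective, semilinear with respect to the field
automorphism `σ`, and dual to each other up to `σ`. -/
structure IsSemilinearOnRankOne {𝕜 X Y : Type*} [RCLike 𝕜] [NormedAddCommGroup X]
    [NormedSpace 𝕜 X] [NormedAddCommGroup Y] [NormedSpace 𝕜 Y]
    {𝒜 : Subalgebra 𝕜 (X →L[𝕜] X)} {ℬ : Subalgebra 𝕜 (Y →L[𝕜] Y)}
    (h𝒜 : IsStandardOperatorAlgebra 𝒜) (hℬ : IsStandardOperatorAlgebra ℬ) (φ : 𝒜 → ℬ)
    (σ : 𝕜 ≃+* 𝕜) (u : X ≃ Y) (v : StrongDual 𝕜 X → StrongDual 𝕜 Y) : Prop where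
  map_rankOne : ∀ x f, φ (h𝒜.rankOne x f) = hℬ.rankOne (u x) (v f)
  dual : ∀ f x, v f (u x) = σ (f x)
  map_add : ∀ x z, u (x + z) = u x + u z
  map_smul : ∀ (c : 𝕜) x, u (c • x) = σ c • u x
  surjective : Function.Surjective v

namespace IsNormalizedPreserver

variable {𝕜 X Y : Type*} [RCLike 𝕜] [NormedAddCommGroup X] [NormedSpace 𝕜 X]
  [NormedAddCommGroup Y] [NormedSpace 𝕜 Y]
  {𝒜 : Subalgebra 𝕜 (X →L[𝕜] X)} {ℬ : Subalgebra 𝕜 (Y →L[𝕜] Y)} {φ : 𝒜 ≃ ℬ} {h : 𝕜 ≃ 𝕜}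

theorem exists_isSemilinearOnRankOne (H : IsNormalizedPreserver φ h)
    (h𝒜 : IsStandardOperatorAlgebra 𝒜) (hℬ : IsStandardOperatorAlgebra ℬ)
    (hX : ¬ FiniteDimensional 𝕜 X) (hY : ¬ FiniteDimensional 𝕜 Y) :
    ∃ σ u v, IsSemilinearOnRankOne h𝒜 hℬ φ σ u v := by
  obtain ⟨u, v, huv⟩ := H.exists_map_rankOne h𝒜 hℬ hX hY
  obtain ⟨u', v', huv'⟩ := H.symm.exists_map_rankOne hℬ h𝒜 hY hX
  obtain ⟨e, he⟩ := exists_linearIndependent_nat hX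
  have he2 : LinearIndependent 𝕜 ![e 0, e 1] := by
    have := he.comp ![0, 1] (by intro i j hij; fin_cases i <;> fin_cases j <;> simp_all)
    convert this using 1
    ext i; fin_cases i <;> rfl
  obtain ⟨f₁, hf₁⟩ := he2.exists_dual_apply_eq ![1, 0]
  obtain ⟨f₂, hf₂⟩ := he2.exists_dual_apply_eq ![0, 1]
  simp only [Fin.forall_fin_two, Matrix.cons_val_zero, Matrix.cons_val_one] at hf₁ hf₂
  have he0 := (ne_zero_and_ne_zero_of_dual_eq_one hf₁.1).1
  have hne : ∀ {x f}, x ≠ 0 → f ≠ 0 → u x ≠ 0 ∧ v f ≠ 0 := by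
    intro x f hx hf
    rw [← not_or, ← hℬ.rankOne_eq_zero_iff, ← huv, H.map_eq_zero_iff, h𝒜.rankOne_eq_zero_iff]
    exact not_or.2 ⟨hx, hf⟩
  have hf₁0 := (ne_zero_and_ne_zero_of_dual_eq_one hf₁.1).2
  have hu0 : u 0 = 0 := by
    have := huv 0 f₁
    rw [H.map_eq_zero_iff.2 (h𝒜.rankOne_eq_zero_iff.2 (Or.inl rfl)), eq_comm,
      hℬ.rankOne_eq_zero_iff] at this
    exact this.resolve_right (hne he0 hf₁0).2
  have hv0 : v 0 = 0 := by
    have := huv (e 0) 0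
    rw [H.map_eq_zero_iff.2 (h𝒜.rankOne_eq_zero_iff.2 (Or.inr rfl)), eq_comm,
      hℬ.rankOne_eq_zero_iff] at this
    exact this.resolve_left (hne he0 hf₁0).1
  -- Comparing the squares of `x ⊗ f` and of its image.
  have hdual : ∀ f x, v f (u x) = h (f x) := by
    intro f x
    by_cases hx : x = 0
    · simp [hx, hu0, H.scalar_zero]
    by_cases hf : f = 0
    · simp [hf, hv0, H.scalar_zero]
    have h1 := H.map_mul_self (h𝒜.rankOne_ne_smul_one hX hx hf) (h𝒜.rankOne_mul_rankOne x x f f)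
    rw [huv, hℬ.rankOne_mul_rankOne] at h1
    exact smul_left_injective 𝕜
      (mt hℬ.rankOne_eq_zero_iff.1 (not_or.2 (hne hx hf))) h1
  have husmul : ∀ (c : 𝕜) x, u (c • x) = h c • u x := by
    intro c x
    by_cases hx : x = 0
    · simp [hx, hu0]
    obtain ⟨f, hf⟩ := SeparatingDual.exists_eq_one (R := 𝕜) hx
    have h1 : hℬ.rankOne (u (c • x)) (v f) = hℬ.rankOne (u x) (v (c • f)) := by
      rw [← huv, ← huv, ← h𝒜.smul_rankOne, ← h𝒜.smul_rankOne']
    have h2 := congrArg (fun T : ℬ => (T : Y →L[𝕜] Y) (u x)) h1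
    simpa [hdual, hf, H.scalar_one] using h2
  have hvsmul : ∀ (c : 𝕜) f, v (c • f) = h c • v f := by
    intro c f
    refine hℬ.rankOne_right_injective (hne he0 hf₁0).1 ?_
    rw [← huv, ← hℬ.smul_rankOne', hℬ.smul_rankOne, ← husmul, ← huv, ← h𝒜.smul_rankOne,
      ← h𝒜.smul_rankOne']
  have husurj : Function.Surjective u := by
    intro y
    by_cases hy : y = 0
    · exact ⟨0, by rw [hu0, hy]⟩
    obtain ⟨g, hg⟩ := SeparatingDual.exists_eq_one (R := 𝕜) hy
    obtain ⟨c, hc⟩ := hℬ.exists_smul_eq_of_rankOne_eq' (ne_zero_and_ne_zero_of_dual_eq_one hg).2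
      (show hℬ.rankOne y g = hℬ.rankOne (u (u' y)) (v (v' g)) by
        rw [← huv, ← huv', φ.apply_symm_apply])
    exact ⟨h.symm c • u' y, by rw [husmul, h.apply_symm_apply, ← hc]⟩
  have hvsurj : Function.Surjective v := by
    intro g
    by_cases hg0 : g = 0
    · exact ⟨0, by rw [hv0, hg0]⟩
    obtain ⟨y, hg⟩ := exists_dual_eq_one_of_ne_zero hg0
    obtain ⟨c, hc⟩ := hℬ.exists_smul_eq_of_rankOne_eq (ne_zero_and_ne_zero_of_dual_eq_one hg).1
      (show hℬ.rankOne y g = hℬ.rankOne (u (u' y)) (v (v' g)) by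
        rw [← huv, ← huv', φ.apply_symm_apply])
    exact ⟨h.symm c • v' g, by rw [hvsmul, h.apply_symm_apply, ← hc]⟩
  have huinj : Function.Injective u := by
    intro x z hxz
    refine h𝒜.rankOne_left_injective hf₁0 (φ.injective ?_)
    rw [huv, huv, hxz]
  have hmul : ∀ a b, h (a * b) = h a * h b := by
    intro a b
    have := husmul (a * b) (e 0)
    rw [mul_smul, husmul, husmul, smul_smul] at this
    exact (smul_left_injective 𝕜 (hne he0 hf₁0).1 this).symm
  -- `v (f₁ + f₂)` vanishes wherever `v f₁` and `v f₂` do, hence is a combination of them; the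
  -- coefficients are read off from the biorthogonal vectors.
  have hspan : ∃ a b : 𝕜, v (f₁ + f₂) = a • v f₁ + b • v f₂ := by
    have hmem : (v (f₁ + f₂) : Y →ₗ[𝕜] 𝕜) ∈ Submodule.span 𝕜
        (Set.range ![(v f₁ : Y →ₗ[𝕜] 𝕜), (v f₂ : Y →ₗ[𝕜] 𝕜)]) := by
      refine mem_span_of_iInf_ker_le_ker fun y hy => ?_
      obtain ⟨x, rfl⟩ := husurj y
      simp only [Submodule.mem_iInf, Fin.forall_fin_two, Matrix.cons_val_zero, Matrix.cons_val_one,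
        LinearMap.mem_ker, ContinuousLinearMap.coe_coe, hdual, H.scalar_eq_zero_iff] at hy ⊢
      simp [hy.1, hy.2]
    rw [Matrix.range_cons, Matrix.range_cons, Matrix.range_empty, Set.union_empty,
      Set.singleton_union, Submodule.mem_span_pair] at hmem
    obtain ⟨a, b, hab⟩ := hmem
    exact ⟨a, b, by ext y; simpa using (congrArg (fun l : Y →ₗ[𝕜] 𝕜 => l y) hab).symm⟩
  obtain ⟨a, b, hab⟩ := hspan
  have hcomb : ∀ x, h (f₁ x + f₂ x) = a * h (f₁ x) + b * h (f₂ x) := by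
    intro x
    simpa [hdual] using congrArg (fun g : StrongDual 𝕜 Y => g (u x)) hab
  have ha : a = 1 := by
    simpa [hf₁, hf₂, H.scalar_one, H.scalar_zero] using (hcomb (e 0)).symm
  have hb : b = 1 := by
    simpa [hf₁, hf₂, H.scalar_one, H.scalar_zero] using (hcomb (e 1)).symm
  have hadd : ∀ s t, h (s + t) = h s + h t := by
    intro s t
    simpa [hf₁, hf₂, ha, hb] using hcomb (s • e 0 + t • e 1)
  refine ⟨RingEquiv.mk h hmul hadd, Equiv.ofBijective u ⟨huinj, husurj⟩, v, huv, hdual,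
    fun x z => ?_, husmul, hvsurj⟩
  rw [SeparatingDual.eq_iff_forall_dual_eq (R := 𝕜)]
  intro g
  obtain ⟨f, rfl⟩ := hvsurj g
  change v f (u (x + z)) = v f (u x + u z)
  rw [map_add, hdual, hdual, hdual, map_add, hadd]

/-- The action on rank-one operators determines the preserver: for `B = x ⊗ f` the square of the
block matrix `!![T * B, T; -(B * T * B), -(B * T)]` is zero, and all its entries except `T` have
rank at most one. -/
theorem map_apply (H : IsNormalizedPreserver φ h)
    {h𝒜 : IsStandardOperatorAlgebra 𝒜} {hℬ : IsStandardOperatorAlgebra ℬ}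
    (hY : ¬ FiniteDimensional 𝕜 Y) {σ : 𝕜 ≃+* 𝕜} {u : X ≃ Y}
    {v : StrongDual 𝕜 X → StrongDual 𝕜 Y} (huv : IsSemilinearOnRankOne h𝒜 hℬ φ σ u v)
    (T : 𝒜) (x : X) : (φ T : Y →L[𝕜] Y) (u x) = u ((T : X →L[𝕜] X) x) := by
  have hu0 : u 0 = 0 := by simpa using huv.map_smul 0 0
  have key : ∀ x, (T : X →L[𝕜] X) x ≠ 0 →
      (φ T : Y →L[𝕜] Y) (u x) = u ((T : X →L[𝕜] X) x) := by
    intro x hx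
    obtain ⟨f, hf⟩ := SeparatingDual.exists_eq_one (R := 𝕜) hx
    have hx0 : x ≠ 0 := by rintro rfl; simp at hx
    have hux0 : u x ≠ 0 := fun h0 => hx0 (u.injective (h0.trans hu0.symm))
    have hvf0 : v f ≠ 0 := by
      intro h0
      simpa [h0, hf] using huv.dual f ((T : X →L[𝕜] X) x)
    have hunx : u (-x) = -u x := by simpa using huv.map_smul (-1) x
    obtain ⟨s, r, h1, -, h3, -⟩ := H.preserves 0 0 (h𝒜.rankOne ((T : X →L[𝕜] X) x) f) T
      (h𝒜.rankOne (-x) f) (h𝒜.rankOne (-x) (f ∘L (T : X →L[𝕜] X))) (by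
        refine ⟨?_, ?_, ?_, ?_⟩ <;> ext z <;> simp [hf])
    have hs : s = 0 := by
      rw [huv.map_rankOne, huv.map_rankOne, huv.map_rankOne, hℬ.rankOne_mul_rankOne,
        hℬ.rankOne_mul_rankOne, huv.dual, huv.dual, ← add_smul] at h3
      have := smul_left_injective 𝕜 (mt hℬ.rankOne_eq_zero_iff.1
        (not_or.2 ⟨by rwa [hunx, neg_eq_zero], hvf0⟩)) h3
      simpa [hf, eq_comm] using this
    rw [huv.map_rankOne, huv.map_rankOne, hℬ.rankOne_mul_rankOne, huv.dual, hf, map_one, one_smul,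
      hℬ.mul_rankOne, hunx, map_neg, hs, zero_smul, zero_sub] at h1
    have h2 : hℬ.rankOne (u ((T : X →L[𝕜] X) x) - (φ T : Y →L[𝕜] Y) (u x)) (v f) = -r • 1 := by
      rw [neg_smul, ← h1]
      ext z
      simp [sub_eq_add_neg]
    have hr := hℬ.eq_zero_of_rankOne_eq_smul_one hY h2
    rw [hr, zero_smul, hℬ.rankOne_eq_zero_iff, or_iff_left hvf0, sub_eq_zero] at h2
    exact h2.symm
  by_cases hx : (T : X →L[𝕜] X) x = 0
  · by_cases hT : ∃ z, (T : X →L[𝕜] X) z ≠ 0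
    · -- A kernel vector is the difference of two vectors outside the kernel.
      obtain ⟨z, hz⟩ := hT
      have h1 := key (x + z) (by simpa [hx] using hz)
      rw [huv.map_add, map_add, map_add, huv.map_add, key z hz] at h1
      exact add_right_cancel h1
    · push Not at hT
      have hT0 : T = 0 := by ext z; simpa using hT z
      rw [hT0, H.map_zero]
      simp [hu0]
  · exact key x hx

end IsNormalizedPreserver

/-! ### Continuity -/

section Continuity

variable {𝕜 X Y : Type*} [RCLike 𝕜] [NormedAddCommGroup X] [NormedSpace 𝕜 X]
  [NormedAddCommGroup Y] [NormedSpace 𝕜 Y]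

/-- A discontinuous field endomorphism takes arbitrarily large values at arbitrarily small
scalars. -/
theorem exists_norm_le_and_le_norm_of_not_continuous {σ : 𝕜 →+* 𝕜} (hσ : ¬ Continuous σ) {ε : ℝ}
    (hε : 0 < ε) (C : ℝ) : ∃ c : 𝕜, ‖c‖ ≤ ε ∧ C ≤ ‖σ c‖ := by
  by_contra! hc
  refine hσ (AddMonoidHom.continuous_of_isBounded_nhds_zero σ.toAddMonoidHom
    (Metric.closedBall_mem_nhds 0 hε) ?_)
  refine (Metric.isBounded_closedBall (x := (0 : 𝕜)) (r := C)).subset ?_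
  rintro _ ⟨c, hcε, rfl⟩
  exact mem_closedBall_zero_iff.2 (hc c (mem_closedBall_zero_iff.1 hcε)).le

/-- If a field endomorphism `σ` intertwines the dualities of an infinite-dimensional space `X` and
of another normed space, then `σ` is continuous. Otherwise a gliding hump produces a functional `F`
on `X` such that `σ (F (x n))` grows faster than `‖u (x n)‖` along a sequence `x`. -/
theorem continuous_of_dual_apply_eq (hX : ¬ FiniteDimensional 𝕜 X) (σ : 𝕜 →+* 𝕜) (u : X → Y)
    (v : StrongDual 𝕜 X → StrongDual 𝕜 Y) (huv : ∀ f x, v f (u x) = σ (f x)) : Continuous σ := by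
  by_contra hσ
  obtain ⟨x, hx⟩ := exists_linearIndependent_nat hX
  have hf : ∀ n, ∃ f : StrongDual 𝕜 X, f (x n) = 1 ∧ ∀ m < n, f (x m) = 0 := by
    intro n
    obtain ⟨f, hf⟩ := (hx.comp ((↑) : Fin (n + 1) → ℕ) Fin.val_injective).exists_dual_apply_eq
      (fun i => if (i : ℕ) = n then 1 else 0)
    exact ⟨f, by simpa using hf ⟨n, by omega⟩, fun m hm => by
      simpa [hm.ne] using hf ⟨m, by omega⟩⟩
  choose f hf1 hf0 using hf
  have hp : ∀ (n : ℕ) (c : 𝕜), ∃ l : 𝕜, ‖l • f n‖ ≤ 1 / 2 / 2 ^ n ∧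
      n * ‖u (x n)‖ + ‖σ c‖ + 1 ≤ ‖σ l‖ := by
    intro n c
    have hpos : 0 < ‖f n‖ := norm_pos_iff.2 (ne_zero_and_ne_zero_of_dual_eq_one (hf1 n)).2
    obtain ⟨l, hl, hl'⟩ := exists_norm_le_and_le_norm_of_not_continuous hσ
      (ε := 1 / 2 / 2 ^ n / ‖f n‖) (by positivity) (n * ‖u (x n)‖ + ‖σ c‖ + 1)
    exact ⟨l, by rw [norm_smul]; exact (le_div_iff₀ hpos).1 hl, hl'⟩
  choose p hp1 hp2 using hp
  let G : ℕ → StrongDual 𝕜 X := fun n =>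
    Nat.rec 0 (fun n F => F + p n (F (x n)) • f n) n
  have hG : ∀ n, G (n + 1) = G n + p n (G n (x n)) • f n := fun n => rfl
  have hdist : ∀ n, dist (G n) (G (n + 1)) ≤ 1 / 2 / 2 ^ n := by
    intro n
    rw [hG, dist_self_add_right]
    exact hp1 n _
  obtain ⟨F, hF⟩ := cauchySeq_tendsto_of_complete (cauchySeq_of_le_geometric_two hdist)
  -- Later summands vanish at `x n`, so the value there is fixed after step `n`.
  have hstable : ∀ n k, G (n + 1 + k) (x n) = G (n + 1) (x n) := by
    intro n k
    induction k with
    | zero => rfl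
    | succ k ih => rw [← add_assoc, hG]; simp [ih, hf0 (n + 1 + k) n (by omega)]
  have hFx : ∀ n, F (x n) = G n (x n) + p n (G n (x n)) := by
    intro n
    have h1 : Filter.Tendsto (fun m => G m (x n)) Filter.atTop (nhds (F (x n))) :=
      ((ContinuousLinearMap.apply 𝕜 𝕜 (x n)).continuous.tendsto F).comp hF
    have h2 : Filter.Tendsto (fun m => G m (x n)) Filter.atTop (nhds (G (n + 1) (x n))) :=
      tendsto_const_nhds.congr' (Filter.eventually_atTop.2 ⟨n + 1, fun m hm => by
        obtain ⟨k, rfl⟩ := Nat.exists_eq_add_of_le hm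
        exact (hstable n k).symm⟩)
    rw [tendsto_nhds_unique h1 h2, hG]
    simp [hf1]
  obtain ⟨n, hn⟩ := exists_nat_ge ‖v F‖
  have h1 : ‖σ (F (x n))‖ ≤ n * ‖u (x n)‖ := by
    rw [← huv]
    exact ((v F).le_opNorm _).trans (by gcongr)
  have h2 : ‖σ (p n (G n (x n)))‖ ≤ ‖σ (F (x n))‖ + ‖σ (G n (x n))‖ := by
    rw [show σ (p n (G n (x n))) = σ (F (x n)) - σ (G n (x n)) by rw [hFx, map_add]; ring]
    exact norm_sub_le _ _
  linarith [hp2 n (G n (x n))]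

/-- The only continuous field endomorphisms of `ℝ` or `ℂ` are the identity and conjugation. -/
theorem RCLike.ringHom_eq_id_or_conj_of_continuous {σ : 𝕜 →+* 𝕜} (hσ : Continuous σ) :
    (∀ c, σ c = c) ∨ ∀ c, σ c = starRingEnd 𝕜 c := by
  have hreal : ∀ r : ℝ, σ (r : 𝕜) = r := by
    intro r
    have := map_real_smul σ hσ r 1
    simpa [RCLike.real_smul_eq_coe_mul] using this
  have hI : σ RCLike.I = RCLike.I ∨ σ RCLike.I = -RCLike.I := by
    rcases RCLike.I_mul_I_ax (K := 𝕜) with h | h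
    · simp [h]
    · rw [← mul_self_eq_mul_self_iff, ← map_mul, h, map_neg, map_one]
  refine hI.imp (fun h c => ?_) fun h c => ?_
  · conv_lhs => rw [← RCLike.re_add_im c]
    rw [map_add, map_mul, hreal, hreal, h, RCLike.re_add_im]
  · conv_lhs => rw [← RCLike.re_add_im c]
    rw [map_add, map_mul, hreal, hreal, h, RCLike.conj_eq_re_sub_im]
    ring

/-- A map into a normed space that has linear growth after composition with every continuous
functional has linear growth, by the uniform boundedness principle. -/
theorem exists_norm_le_mul_norm_of_forall_dual {𝕜 X Y : Type*} [RCLike 𝕜] [NormedAddCommGroup X]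
    [NormedAddCommGroup Y] [NormedSpace 𝕜 Y] {w : X → Y}
    (hw : ∀ g : StrongDual 𝕜 Y, ∃ C : ℝ, ∀ x, ‖g (w x)‖ ≤ C * ‖x‖) (hw0 : w 0 = 0) :
    ∃ C : ℝ, ∀ x, ‖w x‖ ≤ C * ‖x‖ := by
  obtain ⟨C, hC⟩ := banach_steinhaus (E := StrongDual 𝕜 Y) (F := 𝕜)
    (g := fun x : X => NormedSpace.inclusionInDoubleDual 𝕜 Y (((‖x‖ : ℝ) : 𝕜)⁻¹ • w x)) (by
      intro g
      obtain ⟨C, hC⟩ := hw g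
      refine ⟨max C 0, fun x => ?_⟩
      rw [NormedSpace.dual_def, map_smul, norm_smul, norm_inv, RCLike.norm_ofReal, abs_norm]
      rcases eq_or_ne x 0 with rfl | hx
      · simp
      · have := norm_pos_iff.2 hx
        rw [inv_mul_le_iff₀ this]
        calc _ ≤ C * ‖x‖ := hC x
          _ ≤ ‖x‖ * max C 0 := by rw [mul_comm]; gcongr; exact le_max_left _ _)
  refine ⟨C, fun x => ?_⟩
  rcases eq_or_ne x 0 with rfl | hx
  · simp [hw0]
  · have h1 := hC x
    have h2 : ‖NormedSpace.inclusionInDoubleDual 𝕜 Y (((‖x‖ : ℝ) : 𝕜)⁻¹ • w x)‖ =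
        ‖((‖x‖ : ℝ) : 𝕜)⁻¹ • w x‖ := (NormedSpace.inclusionInDoubleDualLi 𝕜).norm_map _
    rw [h2, norm_smul, norm_inv, RCLike.norm_ofReal, abs_norm,
      inv_mul_le_iff₀ (norm_pos_iff.2 hx)] at h1
    rwa [mul_comm]

namespace IsSemilinearOnRankOne

variable {𝒜 : Subalgebra 𝕜 (X →L[𝕜] X)} {ℬ : Subalgebra 𝕜 (Y →L[𝕜] Y)}
  {h𝒜 : IsStandardOperatorAlgebra 𝒜} {hℬ : IsStandardOperatorAlgebra ℬ} {φ : 𝒜 → ℬ}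
  {σ : 𝕜 ≃+* 𝕜} {u : X ≃ Y} {v : StrongDual 𝕜 X → StrongDual 𝕜 Y}

/-- If the automorphism is an isometric involution `τ`, then the vector part of the action on
rank-one operators is an isomorphism of normed spaces. -/
theorem exists_continuousLinearEquiv (huv : IsSemilinearOnRankOne h𝒜 hℬ φ σ u v) (τ : 𝕜 →+* 𝕜)
    [RingHomInvPair τ τ] [RingHomIsometric τ] (hτ : ∀ c, σ c = τ c) :
    ∃ A : X ≃SL[τ] Y, ∀ x, A x = u x := by
  have hnorm : ∀ c, ‖σ c‖ = ‖c‖ := fun c => by rw [hτ, RingHomIsometric.norm_map]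
  have hu0 : u 0 = 0 := by simpa using huv.map_smul 0 0
  obtain ⟨C, hC⟩ := exists_norm_le_mul_norm_of_forall_dual (𝕜 := 𝕜) (w := u) (by
    intro g
    obtain ⟨f, rfl⟩ := huv.surjective g
    exact ⟨‖f‖, fun x => by rw [huv.dual, hnorm]; exact f.le_opNorm x⟩) hu0
  obtain ⟨D, hD⟩ := exists_norm_le_mul_norm_of_forall_dual (𝕜 := 𝕜) (w := u.symm) (by
    intro f
    refine ⟨‖v f‖, fun y => ?_⟩
    rw [← hnorm, ← huv.dual, u.apply_symm_apply]
    exact (v f).le_opNorm y) (by rw [Equiv.symm_apply_eq, hu0])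
  let e : X ≃ₛₗ[τ] Y :=
    { u with
      map_add' := huv.map_add
      map_smul' := fun c x => by rw [← hτ]; exact huv.map_smul c x }
  exact ⟨ContinuousLinearEquiv.mk e (e.toLinearMap.mkContinuous C hC).continuous
    (e.symm.toLinearMap.mkContinuous D hD).continuous, fun x => rfl⟩

end IsSemilinearOnRankOne

end Continuity

/-! ### Scalar multiples of conjugations preserve quadratic operators -/

section Conjugation

/-- A field endomorphism that is the identity or conjugation does not affect whether a monic
quadratic polynomial over `𝕜` splits in `L`: conjugation is trivial for `𝕜 = ℝ`, and for `𝕜 = ℂ`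
every polynomial splits. -/
theorem exists_roots_map {𝕜 L : Type*} [RCLike 𝕜] [Field L] [Algebra 𝕜 L] {σ : 𝕜 →+* 𝕜}
    (hσ : (∀ c, σ c = c) ∨ ∀ c, σ c = starRingEnd 𝕜 c) {s r : 𝕜}
    (h : ∃ a b : L, a + b = algebraMap 𝕜 L s ∧ a * b = algebraMap 𝕜 L r) :
    ∃ a b : L, a + b = algebraMap 𝕜 L (σ s) ∧ a * b = algebraMap 𝕜 L (σ r) := by
  rcases hσ with hσ | hσ
  · simpa only [hσ] using h
  by_cases hI : RCLike.im (RCLike.I : 𝕜) = 1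
  · obtain ⟨w, hw⟩ : ∃ w : 𝕜, w ^ 2 = σ s ^ 2 - 4 * σ r := by
      obtain ⟨z, hz⟩ := IsAlgClosed.exists_pow_nat_eq
        (RCLike.complexRingEquiv hI (σ s ^ 2 - 4 * σ r)) (n := 2) two_pos
      exact ⟨(RCLike.complexRingEquiv hI).symm z, by rw [← map_pow, hz, RingEquiv.symm_apply_apply]⟩
    refine ⟨algebraMap 𝕜 L ((σ s + w) / 2), algebraMap 𝕜 L ((σ s - w) / 2), ?_, ?_⟩
    · rw [← map_add]
      congr 1
      ring
    · rw [← map_mul]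
      congr 1
      linear_combination -hw / 4
  · have him : ∀ c : 𝕜, RCLike.im c = 0 := by
      have h0 : RCLike.im (RCLike.I : 𝕜) = 0 := by
        by_contra h0
        exact hI (mul_right_cancel₀ h0 (by rw [RCLike.I_im, one_mul]))
      intro c
      rw [← RCLike.I_im c, h0, mul_zero]
    have hid : ∀ c : 𝕜, σ c = c := fun c => by rw [hσ, RCLike.conj_eq_iff_im, him]
    simpa only [hid] using h

variable {𝕜 L R S : Type*} [Field L] [Ring R] [Ring S]

theorem IsQuadratic.smul [Field 𝕜] [Algebra 𝕜 L] [Algebra 𝕜 R] {T : R} (h : IsQuadratic 𝕜 L T)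
    (c : 𝕜) : IsQuadratic 𝕜 L (c • T) := by
  obtain ⟨s, r, h1, a, b, hs, hr⟩ := (isQuadratic_iff_exists_mul_self T).1 h
  refine (isQuadratic_iff_exists_mul_self _).2 ⟨c * s, c ^ 2 * r, ?_, algebraMap 𝕜 L c * a,
    algebraMap 𝕜 L c * b, by rw [← mul_add, hs, map_mul], ?_⟩
  · rw [smul_mul_smul_comm, h1, smul_sub, smul_smul, smul_smul, smul_smul]
    congr 2 <;> ring
  · rw [map_mul, map_pow, ← hr]
    ring

theorem isQuadratic_smul_iff [Field 𝕜] [Algebra 𝕜 L] [Algebra 𝕜 R] {T : R} {c : 𝕜} (hc : c ≠ 0) :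
    IsQuadratic 𝕜 L (c • T) ↔ IsQuadratic 𝕜 L T :=
  ⟨fun h => by simpa [smul_smul, hc] using h.smul c⁻¹, fun h => h.smul c⟩

theorem isQuadratic_map_iff [RCLike 𝕜] [Algebra 𝕜 L] [Algebra 𝕜 R] [Algebra 𝕜 S] {τ : 𝕜 →+* 𝕜}
    [RingHomInvPair τ τ] (hτ : (∀ c, τ c = c) ∨ ∀ c, τ c = starRingEnd 𝕜 c) {ψ : R →+* S}
    (hψ : Function.Injective ψ) (hψτ : ∀ (c : 𝕜) T, ψ (c • T) = τ c • ψ T) {T : R} :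
    IsQuadratic 𝕜 L (ψ T) ↔ IsQuadratic 𝕜 L T := by
  have hψ' : ∀ s r : 𝕜, ψ (s • T - r • 1) = τ s • ψ T - τ r • (1 : S) := fun s r => by
    rw [map_sub, hψτ, hψτ, map_one]
  rw [isQuadratic_iff_exists_mul_self, isQuadratic_iff_exists_mul_self]
  constructor
  · rintro ⟨s, r, h, hab⟩
    refine ⟨τ s, τ r, hψ ?_, exists_roots_map hτ hab⟩
    rw [hψ', map_mul, h, RingHomInvPair.comp_apply_eq, RingHomInvPair.comp_apply_eq]
  · rintro ⟨s, r, h, hab⟩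
    exact ⟨τ s, τ r, by rw [← map_mul, h, hψ'], exists_roots_map hτ hab⟩

theorem completelyQuadraticPreserving_of_eq_smul_ringHom [RCLike 𝕜] [Algebra 𝕜 L] [Algebra 𝕜 R]
    [Algebra 𝕜 S] {φ : R → S} (hφ : Function.Injective φ) {τ : 𝕜 →+* 𝕜} [RingHomInvPair τ τ]
    (hτ : (∀ c, τ c = c) ∨ ∀ c, τ c = starRingEnd 𝕜 c) {c : 𝕜} (hc : c ≠ 0) (ψ : R →+* S)
    (hψτ : ∀ (a : 𝕜) T, ψ (a • T) = τ a • ψ T) (hφψ : ∀ T, φ T = c • ψ T) :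
    CompletelyQuadraticPreserving 𝕜 L φ := by
  have hψ : Function.Injective ψ := fun S T h => hφ (by rw [hφψ, hφψ, h])
  intro n _ T
  have hT : T.map φ = c • ψ.mapMatrix T := by
    ext1 i j
    exact hφψ _
  rw [hT, isQuadratic_smul_iff hc]
  have h1 : Function.Injective (ψ.mapMatrix : Matrix (Fin n) (Fin n) R →+* _) :=
    Matrix.map_injective hψ
  have h2 : ∀ (a : 𝕜) (M : Matrix (Fin n) (Fin n) R),
      ψ.mapMatrix (a • M) = τ a • ψ.mapMatrix M := by
    intro a M
    ext1 i j
    exact hψτ a (M i j)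
  exact (isQuadratic_map_iff (L := L) (T := T) hτ h1 h2).symm

theorem completelyQuadraticPreserving_of_smul_conj {X Y : Type*} [RCLike 𝕜] [Algebra 𝕜 L]
    [NormedAddCommGroup X] [NormedSpace 𝕜 X] [NormedAddCommGroup Y] [NormedSpace 𝕜 Y]
    [Nontrivial X] {𝒜 : Subalgebra 𝕜 (X →L[𝕜] X)} {ℬ : Subalgebra 𝕜 (Y →L[𝕜] Y)} {φ : 𝒜 → ℬ}
    (hφ : Function.Injective φ) {τ : 𝕜 →+* 𝕜} [RingHomInvPair τ τ]
    (hτ : (∀ c, τ c = c) ∨ ∀ c, τ c = starRingEnd 𝕜 c) (c : 𝕜) (A : X ≃SL[τ] Y)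
    (hA : ∀ (T : 𝒜) (y : Y), (φ T : Y →L[𝕜] Y) y = c • A ((T : X →L[𝕜] X) (A.symm y))) :
    CompletelyQuadraticPreserving 𝕜 L φ := by
  have hc : c ≠ 0 := by
    rintro rfl
    refine zero_ne_one (hφ ?_ : (0 : 𝒜) = 1)
    ext y
    rw [hA, hA, zero_smul, zero_smul]
  obtain ⟨ψ, hφψ⟩ : ∃ ψ : 𝒜 → ℬ, ∀ T, φ T = c • ψ T :=
    ⟨fun T => c⁻¹ • φ T, fun T => (smul_inv_smul₀ hc _).symm⟩
  have hψ : ∀ (T : 𝒜) (y : Y), (ψ T : Y →L[𝕜] Y) y = A ((T : X →L[𝕜] X) (A.symm y)) := by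
    intro T y
    have := hA T y
    rw [hφψ] at this
    exact smul_right_injective Y hc this
  refine completelyQuadraticPreserving_of_eq_smul_ringHom hφ hτ hc
    { toFun := ψ, map_one' := ?_, map_mul' := ?_, map_zero' := ?_, map_add' := ?_ } ?_ hφψ
  · ext y
    simp [hψ]
  · intro S T
    ext y
    simp [hψ]
  · ext y
    simp [hψ]
  · intro S T
    ext y
    simp [hψ]
  · intro a T
    ext y
    change (ψ (a • T) : Y →L[𝕜] Y) y = τ a • (ψ T : Y →L[𝕜] Y) y
    rw [hψ, hψ]
    exact A.map_smulₛₗ a _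

theorem IsScalarConjugation.completelyQuadraticPreserving {X Y : Type*} [RCLike 𝕜] [Algebra 𝕜 L]
    [NormedAddCommGroup X] [NormedSpace 𝕜 X] [NormedAddCommGroup Y] [NormedSpace 𝕜 Y]
    [Nontrivial X] {𝒜 : Subalgebra 𝕜 (X →L[𝕜] X)} {ℬ : Subalgebra 𝕜 (Y →L[𝕜] Y)} {φ : 𝒜 → ℬ}
    (h : IsScalarConjugation φ) (hφ : Function.Injective φ) :
    CompletelyQuadraticPreserving 𝕜 L φ := by
  obtain ⟨c, ⟨A, hA⟩ | ⟨A, hA⟩⟩ := h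
  · exact completelyQuadraticPreserving_of_smul_conj hφ (Or.inl fun _ => rfl) c A hA
  · exact completelyQuadraticPreserving_of_smul_conj hφ (Or.inr fun _ => rfl) c A hA

end Conjugation

/-! ### The characterization -/

theorem QuadraticPreserving.isScalarConjugation {𝕜 L X Y : Type*} [RCLike 𝕜] [Field L]
    [Algebra 𝕜 L] [NormedAddCommGroup X] [NormedSpace 𝕜 X] [NormedAddCommGroup Y] [NormedSpace 𝕜 Y]
    [Nontrivial X] [Nontrivial Y]
    (hX : ¬ FiniteDimensional 𝕜 X) (hY : ¬ FiniteDimensional 𝕜 Y)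
    {𝒜 : Subalgebra 𝕜 (X →L[𝕜] X)} {ℬ : Subalgebra 𝕜 (Y →L[𝕜] Y)}
    (h𝒜 : IsStandardOperatorAlgebra 𝒜) (hℬ : IsStandardOperatorAlgebra ℬ)
    {φ : 𝒜 ≃ ℬ} (hφ : QuadraticPreserving 𝕜 L 2 φ) : IsScalarConjugation φ := by
  have hN : ∃ N : ℬ, ∀ c : 𝕜, N ≠ c • (1 : ℬ) := by
    obtain ⟨y, hy⟩ := exists_ne (0 : Y)
    obtain ⟨g, hg⟩ := SeparatingDual.exists_eq_one (R := 𝕜) hy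
    exact ⟨hℬ.rankOne y g,
      hℬ.rankOne_ne_smul_one hY hy (ne_zero_and_ne_zero_of_dual_eq_one hg).2⟩
  obtain ⟨c, ψ, h, H, hφψ⟩ := exists_isNormalizedPreserver hφ.preservesBlockQuadratic
    hφ.preservesBlockQuadratic_symm hN
  obtain ⟨σ, u, v, huv⟩ := H.exists_isSemilinearOnRankOne h𝒜 hℬ hX hY
  have hσ : Continuous (σ : 𝕜 →+* 𝕜) := continuous_of_dual_apply_eq hX _ u v huv.dual
  have key : ∀ (T : 𝒜) (x : X),
      (φ T : Y →L[𝕜] Y) (u x) = c • u ((T : X →L[𝕜] X) x) := by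
    intro T x
    rw [← H.map_apply hY huv, hφψ]
    rfl
  refine ⟨c, (RCLike.ringHom_eq_id_or_conj_of_continuous hσ).imp (fun hid => ?_) fun hconj => ?_⟩
  · obtain ⟨A, hA⟩ := huv.exists_continuousLinearEquiv (RingHom.id 𝕜) hid
    refine ⟨A, fun T y => ?_⟩
    rw [hA, ← key, ← hA, A.apply_symm_apply]
  · obtain ⟨A, hA⟩ := huv.exists_continuousLinearEquiv (starRingEnd 𝕜) hconj
    refine ⟨A, fun T y => ?_⟩
    rw [hA, ← key, ← hA, A.apply_symm_apply]

/-- The scalars are `𝕜 = ℝ` or `ℂ`. The numbers `a, b` in the definition of a quadratic operator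
range over `L`, which is `𝕜` itself or, if `𝕜 = ℝ`, possibly `ℂ`. -/
theorem theorem1p1 {𝕜 L X Y : Type*} [RCLike 𝕜] [RCLike L] [NormedAlgebra 𝕜 L]
    [NormedAddCommGroup X] [NormedSpace 𝕜 X] [CompleteSpace X]
    [NormedAddCommGroup Y] [NormedSpace 𝕜 Y] [CompleteSpace Y]
    (hX : ¬ FiniteDimensional 𝕜 X) (hY : ¬ FiniteDimensional 𝕜 Y)
    (𝒜 : Subalgebra 𝕜 (X →L[𝕜] X)) (ℬ : Subalgebra 𝕜 (Y →L[𝕜] Y))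
    (h𝒜 : IsStandardOperatorAlgebra 𝒜) (hℬ : IsStandardOperatorAlgebra ℬ)
    (φ : 𝒜 → ℬ) (hφ : Function.Bijective φ) :
    List.TFAE [CompletelyQuadraticPreserving 𝕜 L φ,
      QuadraticPreserving 𝕜 L 2 φ,
      IsScalarConjugation φ] := by
  have : Nontrivial X := not_subsingleton_iff_nontrivial.1 fun _ => hX inferInstance
  have : Nontrivial Y := not_subsingleton_iff_nontrivial.1 fun _ => hY inferInstance
  tfae_have 1 → 2 := fun h => h 2 one_le_two
  tfae_have 2 → 3 := fun h =>
    QuadraticPreserving.isScalarConjugation hX hY h𝒜 hℬ (φ := Equiv.ofBijective φ hφ) h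
  tfae_have 3 → 1 := fun h => h.completelyQuadraticPreserving hφ.injective
  tfae_finish
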